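/- A \emph{tree-like tableau} is a Young diagram (in English notation) some of whose cells contain a point, such that: the top left cell contains a point (the root point); for each non-root point there is either a point above it in the same column or a point to its left in the same row, but not both; and every row and every column contains a point. Its \emph{size} is its number of points, and $\mathcal T_n$ denotes the set of tree-like tableaux of size $n$. A \emph{corner} is a cell whose bottom and right edges both belong to the Southeast border of the diagram; it is \emph{occupied} if it contains a point, and $oc(T)$ is the number of occupied corners of $T$. Then for every $n\ge 1$, $$\sum_{T\in\mathcal T_n} oc(T)=n!,$$ and on average a tree-like tableau of size $n$ has one occupied corner, that is, $$\frac{1}{|\mathcal T_n|}\sum_{T\in\mathcal T_n}oc(T)=1.$$ -/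

import Mathlib

/-- A tree-like tableau: a Young diagram some of whose cells contain a point (English notation,
the cell `(i, j)` is in row `i`, counted downwards, and column `j`, counted rightwards, both
from `0`). -/
@[ext]
structure TreeLikeTableau where
  /-- The underlying Young diagram. -/
  shape : YoungDiagram
  /-- The cells that contain a point. -/
  points : Finset (ℕ × ℕ)
  /-- Points lie in cells of the diagram. -/
  points_subset : points ⊆ shape.cells
  /-- The top left cell has a point, the root point. -/
  root_mem : (0, 0) ∈ points
  /-- For each non-root point there is a point above it in its column or a point to its left in
  its row, but not both. -/
  parent : ∀ i j : ℕ, (i, j) ∈ points → (i, j) ≠ (0, 0) →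
    Xor (∃ i' < i, (i', j) ∈ points) (∃ j' < j, (i, j') ∈ points)
  /-- Every row of the diagram contains a point. -/
  row_nonempty : ∀ i j : ℕ, (i, j) ∈ shape → ∃ j', (i, j') ∈ points
  /-- Every column of the diagram contains a point. -/
  col_nonempty : ∀ i j : ℕ, (i, j) ∈ shape → ∃ i', (i', j) ∈ points

namespace TreeLikeTableau

/-- The size of a tree-like tableau is its number of points. -/
def size (T : TreeLikeTableau) : ℕ := T.points.card

/-- The corners: the cells whose bottom and right edges both lie on the Southeast border, i.e. the
cell below and the cell to the right are outside the diagram. -/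
def corners (T : TreeLikeTableau) : Finset (ℕ × ℕ) :=
  T.shape.cells.filter fun c => (c.1 + 1, c.2) ∉ T.shape ∧ (c.1, c.2 + 1) ∉ T.shape

/-- The occupied corners: the corners that contain a point. -/
def occupiedCorners (T : TreeLikeTableau) : Finset (ℕ × ℕ) :=
  T.corners.filter fun c => c ∈ T.points

/-- The number of occupied corners of a tree-like tableau. -/
def oc (T : TreeLikeTableau) : ℕ := T.occupiedCorners.card

theorem shape_subset (T : TreeLikeTableau) :
    T.shape.cells ⊆ Finset.range T.size ×ˢ Finset.range T.size := by
  rintro ⟨i, j⟩ h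
  rw [YoungDiagram.mem_cells] at h
  have hi : Finset.range (i + 1) ⊆ T.points.image Prod.fst := by
    intro k hk
    obtain ⟨j', hj'⟩ := T.row_nonempty k j
      (T.shape.up_left_mem (Nat.lt_succ_iff.mp (Finset.mem_range.mp hk)) le_rfl h)
    exact Finset.mem_image.mpr ⟨_, hj', rfl⟩
  have hj : Finset.range (j + 1) ⊆ T.points.image Prod.snd := by
    intro k hk
    obtain ⟨i', hi'⟩ := T.col_nonempty i k
      (T.shape.up_left_mem le_rfl (Nat.lt_succ_iff.mp (Finset.mem_range.mp hk)) h)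
    exact Finset.mem_image.mpr ⟨_, hi', rfl⟩
  have hi' := (Finset.card_le_card hi).trans Finset.card_image_le
  have hj' := (Finset.card_le_card hj).trans Finset.card_image_le
  rw [Finset.card_range] at hi' hj'
  exact Finset.mem_product.mpr ⟨Finset.mem_range.mpr hi', Finset.mem_range.mpr hj'⟩

theorem finite_setOf_size_eq (n : ℕ) : {T : TreeLikeTableau | T.size = n}.Finite := by
  let B := (Finset.range n ×ˢ Finset.range n).powerset
  refine Set.Finite.of_finite_image (f := fun T => (T.shape.cells, T.points))
    ((B ×ˢ B).finite_toSet.subset ?_) ?_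
  · rintro _ ⟨T, rfl, rfl⟩
    have h := T.shape_subset
    exact Finset.mem_coe.mpr (Finset.mem_product.mpr
      ⟨Finset.mem_powerset.mpr h, Finset.mem_powerset.mpr (T.points_subset.trans h)⟩)
  · intro T _ T' _ h
    obtain ⟨h1, h2⟩ := Prod.mk.inj h
    exact TreeLikeTableau.ext (YoungDiagram.ext h1) h2

/-- The (finite) set of tree-like tableaux of size `n`. -/
noncomputable def ofSize (n : ℕ) : Finset TreeLikeTableau :=
  (finite_setOf_size_eq n).toFinset

theorem mem_ofSize {n : ℕ} {T : TreeLikeTableau} : T ∈ ofSize n ↔ T.size = n := by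
  simp [ofSize]

end TreeLikeTableau

namespace TreeLikeTableau

/-! The sum of `oc` is evaluated in two ways, which together give a recursion for the number of
tableaux. In any tableau the corners outnumber the inner corners by one
(`card_innerCorners_add_one`). Removing an empty corner turns it into an inner corner, reversibly
and without touching the points, so over each size there are as many empty corners as inner ones
(`sum_card_emptyCorners`). Cancelling them leaves `sum_oc_eq_card`: one occupied corner on average.
An occupied non-root corner with a point to its left is alone in its column. Deleting that column
gives a tableau one smaller with a marked row, and this is reversible (`sum_card_rightCorners`).
Transposition treats corners with a point above, which give marked columns. Rows and columns
together number one more than the size (`colLen_add_rowLen`), so the sum over size `n + 1` is `n +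
1` times the number of tableaux of size `n` (`sum_oc_succ`). Comparing the two values, the count is
`n!`. -/

theorem mem_shape_of_mem_points {T : TreeLikeTableau} {c : ℕ × ℕ} (h : c ∈ T.points) :
    c ∈ T.shape :=
  (YoungDiagram.mem_cells _).mp (T.points_subset h)

theorem root_mem_shape (T : TreeLikeTableau) : (0, 0) ∈ T.shape :=
  mem_shape_of_mem_points T.root_mem

theorem mem_corners {T : TreeLikeTableau} {i j : ℕ} :
    (i, j) ∈ T.corners ↔ (i, j) ∈ T.shape ∧ (i + 1, j) ∉ T.shape ∧ (i, j + 1) ∉ T.shape := by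
  simp [corners]

/-! ### Transposition -/

/-- The reflection of a tree-like tableau in its main diagonal. -/
def transpose (T : TreeLikeTableau) : TreeLikeTableau where
  shape := T.shape.transpose
  points := T.points.map (Equiv.prodComm ℕ ℕ).toEmbedding
  points_subset := by
    rintro ⟨i, j⟩ h
    simp only [Finset.mem_map_equiv, Equiv.prodComm_symm, Equiv.prodComm_apply,
      Prod.swap_prod_mk] at h
    simpa using mem_shape_of_mem_points h
  root_mem := by simpa using T.root_mem
  parent i j h h0 := by
    simp only [Finset.mem_map_equiv, Equiv.prodComm_symm, Equiv.prodComm_apply,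
      Prod.swap_prod_mk] at h ⊢
    exact (T.parent j i h (by simp_all [and_comm])).symm
  row_nonempty i j h := by
    obtain ⟨k, hk⟩ := T.col_nonempty j i (by simpa using h)
    exact ⟨k, by simpa using hk⟩
  col_nonempty i j h := by
    obtain ⟨k, hk⟩ := T.row_nonempty j i (by simpa using h)
    exact ⟨k, by simpa using hk⟩

@[simp]
theorem mem_transpose_points {T : TreeLikeTableau} {i j : ℕ} :
    (i, j) ∈ T.transpose.points ↔ (j, i) ∈ T.points := by
  simp [transpose]

@[simp]
theorem mem_transpose_shape {T : TreeLikeTableau} {i j : ℕ} :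
    (i, j) ∈ T.transpose.shape ↔ (j, i) ∈ T.shape := by
  simp [transpose]

@[simp]
theorem transpose_transpose (T : TreeLikeTableau) : T.transpose.transpose = T := by
  apply TreeLikeTableau.ext
  · exact T.shape.transpose_transpose
  · ext ⟨i, j⟩
    simp

@[simp]
theorem size_transpose (T : TreeLikeTableau) : T.transpose.size = T.size :=
  Finset.card_map _

theorem sum_ofSize_transpose (n : ℕ) (f : TreeLikeTableau → ℕ) :
    ∑ T ∈ ofSize n, f T.transpose = ∑ T ∈ ofSize n, f T :=
  Finset.sum_nbij' transpose transpose (by simp [mem_ofSize]) (by simp [mem_ofSize])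
    (by simp) (by simp) (by simp)

/-! ### Rows and columns -/

/-- The non-root points with a point above them in their column. -/
def belowPoints (T : TreeLikeTableau) : Finset (ℕ × ℕ) :=
  open Classical in T.points.filter fun c => ∃ i' < c.1, (i', c.2) ∈ T.points

/-- The non-root points with a point to their left in their row. -/
def rightPoints (T : TreeLikeTableau) : Finset (ℕ × ℕ) :=
  open Classical in T.points.filter fun c => ∃ j' < c.2, (c.1, j') ∈ T.points

theorem mem_belowPoints {T : TreeLikeTableau} {i j : ℕ} :
    (i, j) ∈ T.belowPoints ↔ (i, j) ∈ T.points ∧ ∃ i' < i, (i', j) ∈ T.points := by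
  simp [belowPoints]

theorem mem_rightPoints {T : TreeLikeTableau} {i j : ℕ} :
    (i, j) ∈ T.rightPoints ↔ (i, j) ∈ T.points ∧ ∃ j' < j, (i, j') ∈ T.points := by
  simp [rightPoints]

theorem rightPoints_eq_map_transpose (T : TreeLikeTableau) :
    T.rightPoints = T.transpose.belowPoints.map (Equiv.prodComm ℕ ℕ).toEmbedding := by
  ext ⟨i, j⟩
  simp [mem_belowPoints, mem_rightPoints]

theorem not_above_and_left (T : TreeLikeTableau) {i j i' j' : ℕ} (h : (i, j) ∈ T.points)
    (hi : i' < i) (hi' : (i', j) ∈ T.points) (hj : j' < j) (hj' : (i, j') ∈ T.points) : False := by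
  have h0 : (i, j) ≠ (0, 0) := by
    rintro ⟨⟩
    omega
  rcases T.parent i j h h0 with ⟨-, h2⟩ | ⟨-, h2⟩
  · exact h2 ⟨_, hj, hj'⟩
  · exact h2 ⟨_, hi, hi'⟩

theorem above_or_left (T : TreeLikeTableau) {i j : ℕ} (h : (i, j) ∈ T.points)
    (h0 : (i, j) ≠ (0, 0)) :
    (∃ i' < i, (i', j) ∈ T.points) ∨ (∃ j' < j, (i, j') ∈ T.points) :=
  (T.parent i j h h0).or

/-- Each row except the top one contributes exactly one such point, its leftmost: having nothing to
its left, it has a point above. A second one further right would have points both above and to the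
left. -/
theorem card_belowPoints_add_one (T : TreeLikeTableau) :
    T.belowPoints.card + 1 = T.shape.colLen 0 := by
  have hpos : 0 < T.shape.colLen 0 := YoungDiagram.mem_iff_lt_colLen.mp T.root_mem_shape
  suffices h : T.belowPoints.card = (Finset.Ico 1 (T.shape.colLen 0)).card by
    rw [h, Nat.card_Ico]
    omega
  refine Finset.card_bij (fun c _ => c.1) ?_ ?_ ?_
  · rintro ⟨i, j⟩ h
    obtain ⟨h, i', hi, -⟩ := mem_belowPoints.mp h
    have := YoungDiagram.mem_iff_lt_colLen.mp
      (T.shape.up_left_mem le_rfl (Nat.zero_le j) (mem_shape_of_mem_points h))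
    exact Finset.mem_Ico.mpr ⟨by simp only; omega, this⟩
  · rintro ⟨i, j⟩ h ⟨k, l⟩ h' (rfl : i = k)
    obtain ⟨h, a, ha, ha'⟩ := mem_belowPoints.mp h
    obtain ⟨h', b, hb, hb'⟩ := mem_belowPoints.mp h'
    rcases lt_trichotomy j l with hl | rfl | hl
    · exact (T.not_above_and_left h' hb hb' hl h).elim
    · rfl
    · exact (T.not_above_and_left h ha ha' hl h').elim
  · intro i hi
    obtain ⟨hi1, hi2⟩ := Finset.mem_Ico.mp hi
    have hex := T.row_nonempty i 0 (YoungDiagram.mem_iff_lt_colLen.mpr hi2)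
    classical
    have hp := Nat.find_spec hex
    refine ⟨(i, Nat.find hex), mem_belowPoints.mpr ⟨hp, ?_⟩, rfl⟩
    rcases T.above_or_left hp (by simp; omega) with h | ⟨j', hj, hj'⟩
    · exact h
    · exact (Nat.find_min hex hj hj').elim

theorem card_rightPoints_add_one (T : TreeLikeTableau) :
    T.rightPoints.card + 1 = T.shape.rowLen 0 := by
  rw [rightPoints_eq_map_transpose, Finset.card_map, card_belowPoints_add_one]
  exact T.shape.colLen_transpose 0

theorem disjoint_belowPoints_rightPoints (T : TreeLikeTableau) :
    Disjoint T.belowPoints T.rightPoints := by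
  rw [Finset.disjoint_left]
  rintro ⟨i, j⟩ h h'
  obtain ⟨h, a, ha, ha'⟩ := mem_belowPoints.mp h
  obtain ⟨-, b, hb, hb'⟩ := mem_rightPoints.mp h'
  exact T.not_above_and_left h ha ha' hb hb'

theorem belowPoints_union_rightPoints (T : TreeLikeTableau) :
    T.belowPoints ∪ T.rightPoints = T.points.erase (0, 0) := by
  ext ⟨i, j⟩
  rw [Finset.mem_union, mem_belowPoints, mem_rightPoints, Finset.mem_erase, ← and_or_left, and_comm]
  refine and_congr_left fun h => ⟨?_, T.above_or_left h⟩
  rintro (⟨k, hk, -⟩ | ⟨k, hk, -⟩) ⟨⟩ <;> omega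

/-- The number of rows plus the number of columns exceeds the size by one. -/
theorem colLen_add_rowLen (T : TreeLikeTableau) :
    T.shape.colLen 0 + T.shape.rowLen 0 = T.size + 1 := by
  have h := Finset.card_union_of_disjoint T.disjoint_belowPoints_rightPoints
  rw [belowPoints_union_rightPoints, Finset.card_erase_of_mem T.root_mem] at h
  have := T.card_belowPoints_add_one
  have := T.card_rightPoints_add_one
  have : 0 < T.points.card := Finset.card_pos.mpr ⟨_, T.root_mem⟩
  unfold size
  omega

/-! ### Empty corners -/

/-- The corners that do not contain a point. -/
def emptyCorners (T : TreeLikeTableau) : Finset (ℕ × ℕ) :=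
  T.corners.filter fun c => c ∉ T.points

theorem oc_add_card_emptyCorners (T : TreeLikeTableau) :
    T.oc + T.emptyCorners.card = T.corners.card :=
  Finset.card_filter_add_card_filter_not _

theorem mem_emptyCorners {T : TreeLikeTableau} {i j : ℕ} :
    (i, j) ∈ T.emptyCorners ↔
      ((i, j) ∈ T.shape ∧ (i + 1, j) ∉ T.shape ∧ (i, j + 1) ∉ T.shape) ∧ (i, j) ∉ T.points := by
  rw [emptyCorners, Finset.mem_filter, mem_corners]

/-- The cells outside the diagram that have diagram cells both above and to the left. -/
def innerCorners (T : TreeLikeTableau) : Finset (ℕ × ℕ) :=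
  (T.corners.image fun c => (c.1 + 1, T.shape.rowLen (c.1 + 1))).filter fun c => 0 < c.2

/-- The definition through corners serves the counting; this geometric form serves adding and
removing cells. -/
theorem mem_innerCorners {T : TreeLikeTableau} {i j : ℕ} :
    (i, j) ∈ T.innerCorners ↔
      (i, j) ∉ T.shape ∧ ∃ a b, i = a + 1 ∧ j = b + 1 ∧ (a, j) ∈ T.shape ∧ (i, b) ∈ T.shape := by
  simp only [innerCorners, Finset.mem_filter, Finset.mem_image, Prod.exists, Prod.mk.injEq,
    mem_corners, YoungDiagram.mem_iff_lt_rowLen]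
  constructor
  · rintro ⟨⟨a, b, ⟨h1, h2, h3⟩, rfl, rfl⟩, h⟩
    exact ⟨by omega, a, _, rfl, (Nat.sub_add_cancel h).symm, by omega, by omega⟩
  · rintro ⟨h, a, b, rfl, rfl, h1, h2⟩
    exact ⟨⟨a, T.shape.rowLen a - 1, ⟨by omega, by omega, by omega⟩, rfl, by omega⟩, by omega⟩

/-- Along the border corners and inner corners alternate: every corner but the one in the last row
`m` is followed by the inner corner at the end of the next row. -/
theorem card_innerCorners_add_one (T : TreeLikeTableau) :
    T.innerCorners.card + 1 = T.corners.card := by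
  have hpos : 0 < T.shape.colLen 0 := YoungDiagram.mem_iff_lt_colLen.mp T.root_mem_shape
  set m := T.shape.colLen 0 - 1 with hm
  have key (i : ℕ) : 0 < T.shape.rowLen i ↔ i ≤ m := by
    rw [← YoungDiagram.mem_iff_lt_rowLen, YoungDiagram.mem_iff_lt_colLen]
    omega
  have hmem : (m, T.shape.rowLen m - 1) ∈ T.corners := by
    have h1 := (key m).mpr le_rfl
    have h2 := (key (m + 1)).not.mpr (by omega)
    simp only [mem_corners, YoungDiagram.mem_iff_lt_rowLen]
    omega
  rw [← Finset.card_erase_add_one hmem]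
  congr 1
  symm
  refine Finset.card_bij (fun c _ => (c.1 + 1, T.shape.rowLen (c.1 + 1))) ?_ ?_ ?_
  · rintro ⟨i, j⟩ h
    obtain ⟨h0, h⟩ := Finset.mem_erase.mp h
    refine Finset.mem_filter.mpr ⟨Finset.mem_image_of_mem _ h, (key _).mpr ?_⟩
    simp only [mem_corners, YoungDiagram.mem_iff_lt_rowLen] at h
    have hj : j = T.shape.rowLen i - 1 := by omega
    have := (key i).mp (by omega)
    by_contra hi
    obtain rfl : i = m := by simp only at hi; omega
    exact h0 (by rw [hj])
  · rintro ⟨i, j⟩ h ⟨k, l⟩ h' e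
    obtain rfl : i = k := by simpa using congrArg Prod.fst e
    have h := Finset.mem_of_mem_erase h
    have h' := Finset.mem_of_mem_erase h'
    simp only [mem_corners, YoungDiagram.mem_iff_lt_rowLen] at h h'
    exact Prod.ext rfl (by simp only; omega)
  · rintro c h
    obtain ⟨h, hc⟩ := Finset.mem_filter.mp h
    obtain ⟨d, hd, rfl⟩ := Finset.mem_image.mp h
    refine ⟨d, Finset.mem_erase.mpr ⟨?_, hd⟩, rfl⟩
    rintro rfl
    have := (key _).mp hc
    simp at this

/-- Remove an empty corner. -/
def removeCorner (T : TreeLikeTableau) (c : ℕ × ℕ) (h : c ∈ T.emptyCorners) :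
    TreeLikeTableau where
  shape :=
    { cells := T.shape.cells.erase c
      isLowerSet := by
        obtain ⟨i, j⟩ := c
        have h := mem_emptyCorners.mp h
        rintro ⟨a, b⟩ ⟨a', b'⟩ ⟨ha, hb⟩ hab
        simp only [Finset.coe_erase, Set.mem_sdiff, Finset.mem_coe, YoungDiagram.mem_cells,
          Set.mem_singleton_iff, Prod.mk.injEq] at hab ⊢
        simp only at ha hb
        refine ⟨T.shape.up_left_mem ha hb hab.1, ?_⟩
        rintro ⟨rfl, rfl⟩
        rcases lt_or_eq_of_le ha with ha | rfl
        · exact h.1.2.1 (T.shape.up_left_mem ha hb hab.1)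
        · have : b' < b := by omega
          exact h.1.2.2 (T.shape.up_left_mem ha this hab.1) }
  points := T.points
  points_subset x hx := by
    refine Finset.mem_erase.mpr ⟨?_, T.points_subset hx⟩
    rintro rfl
    exact (mem_emptyCorners.mp h).2 hx
  root_mem := T.root_mem
  parent := T.parent
  row_nonempty i j h := T.row_nonempty i j (Finset.mem_of_mem_erase h)
  col_nonempty i j h := T.col_nonempty i j (Finset.mem_of_mem_erase h)

theorem mem_removeCorner_shape {T : TreeLikeTableau} {c x : ℕ × ℕ} {h : c ∈ T.emptyCorners} :
    x ∈ (T.removeCorner c h).shape ↔ x ≠ c ∧ x ∈ T.shape :=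
  Finset.mem_erase

/-- Add an empty cell at an inner corner. -/
def addCorner (T : TreeLikeTableau) (c : ℕ × ℕ) (h : c ∈ T.innerCorners) : TreeLikeTableau where
  shape :=
    { cells := insert c T.shape.cells
      isLowerSet := by
        obtain ⟨i, j⟩ := c
        obtain ⟨h0, i, j, rfl, rfl, h1, h2⟩ := mem_innerCorners.mp h
        rintro ⟨a, b⟩ ⟨a', b'⟩ ⟨ha, hb⟩ hab
        simp only [Finset.coe_insert, Set.mem_insert_iff, Finset.mem_coe, YoungDiagram.mem_cells,
          Prod.mk.injEq] at hab ⊢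
        simp only at ha hb
        rcases hab with ⟨rfl, rfl⟩ | hab
        · rcases lt_or_eq_of_le ha with ha | rfl
          · exact .inr (T.shape.up_left_mem (Nat.lt_succ_iff.mp ha) hb h1)
          · rcases lt_or_eq_of_le hb with hb | rfl
            · exact .inr (T.shape.up_left_mem le_rfl (Nat.lt_succ_iff.mp hb) h2)
            · exact .inl ⟨rfl, rfl⟩
        · exact .inr (T.shape.up_left_mem ha hb hab) }
  points := T.points
  points_subset := T.points_subset.trans (Finset.subset_insert _ _)
  root_mem := T.root_mem
  parent := T.parent
  row_nonempty i j hij := by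
    rcases Finset.mem_insert.mp hij with rfl | hij
    · obtain ⟨-, a, b, -, -, -, h2⟩ := mem_innerCorners.mp h
      exact T.row_nonempty _ _ h2
    · exact T.row_nonempty _ _ hij
  col_nonempty i j hij := by
    rcases Finset.mem_insert.mp hij with rfl | hij
    · obtain ⟨-, a, b, -, -, h1, -⟩ := mem_innerCorners.mp h
      exact T.col_nonempty _ _ h1
    · exact T.col_nonempty _ _ hij

theorem mem_addCorner_shape {T : TreeLikeTableau} {c x : ℕ × ℕ} {h : c ∈ T.innerCorners} :
    x ∈ (T.addCorner c h).shape ↔ x = c ∨ x ∈ T.shape :=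
  Finset.mem_insert

/-- An empty corner is never in row `0` or column `0`: it would be the only cell of its column or
row, which must contain a point. So it has neighbours above and to the left. -/
theorem mem_innerCorners_removeCorner {T : TreeLikeTableau} {c : ℕ × ℕ}
    (h : c ∈ T.emptyCorners) : c ∈ (T.removeCorner c h).innerCorners := by
  obtain ⟨i, j⟩ := c
  obtain ⟨⟨h0, h1, h2⟩, hp⟩ := mem_emptyCorners.mp h
  rw [mem_innerCorners]
  simp only [mem_removeCorner_shape]
  refine ⟨by simp, ?_⟩
  obtain _ | i := i
  · obtain ⟨k, hk⟩ := T.col_nonempty _ _ h0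
    obtain _ | k := k
    · exact (hp hk).elim
    · exact (h1 (T.shape.up_left_mem (by omega) le_rfl (mem_shape_of_mem_points hk))).elim
  obtain _ | j := j
  · obtain ⟨k, hk⟩ := T.row_nonempty _ _ h0
    obtain _ | k := k
    · exact (hp hk).elim
    · exact (h2 (T.shape.up_left_mem le_rfl (by omega) (mem_shape_of_mem_points hk))).elim
  exact ⟨i, j, rfl, rfl, ⟨by simp, T.shape.up_left_mem (Nat.le_succ i) le_rfl h0⟩, by simp,
    T.shape.up_left_mem le_rfl (Nat.le_succ j) h0⟩

theorem mem_emptyCorners_addCorner {T : TreeLikeTableau} {c : ℕ × ℕ}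
    (h : c ∈ T.innerCorners) : c ∈ (T.addCorner c h).emptyCorners := by
  obtain ⟨i, j⟩ := c
  obtain ⟨h0, -⟩ := mem_innerCorners.mp h
  rw [mem_emptyCorners]
  simp only [mem_addCorner_shape]
  refine ⟨⟨by simp, ?_, ?_⟩, fun hp => h0 (mem_shape_of_mem_points hp)⟩
  · rintro (h | h)
    · simp at h
    · exact h0 (T.shape.up_left_mem (Nat.le_succ i) le_rfl h)
  · rintro (h | h)
    · simp at h
    · exact h0 (T.shape.up_left_mem le_rfl (Nat.le_succ j) h)

theorem addCorner_removeCorner {T : TreeLikeTableau} {c : ℕ × ℕ} (h : c ∈ T.emptyCorners) :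
    (T.removeCorner c h).addCorner c (mem_innerCorners_removeCorner h) = T :=
  TreeLikeTableau.ext (YoungDiagram.ext (Finset.insert_erase (Finset.mem_filter.mp
    (Finset.mem_filter.mp h).1).1)) rfl

theorem removeCorner_addCorner {T : TreeLikeTableau} {c : ℕ × ℕ} (h : c ∈ T.innerCorners) :
    (T.addCorner c h).removeCorner c (mem_emptyCorners_addCorner h) = T :=
  TreeLikeTableau.ext (YoungDiagram.ext (Finset.erase_insert
    fun h' => (mem_innerCorners.mp h).1 ((YoungDiagram.mem_cells _).mp h'))) rfl

theorem sum_card_emptyCorners (n : ℕ) :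
    ∑ T ∈ ofSize n, T.emptyCorners.card = ∑ T ∈ ofSize n, T.innerCorners.card := by
  rw [← Finset.card_sigma, ← Finset.card_sigma]
  refine Finset.card_bij'
    (fun x hx => ⟨x.1.removeCorner x.2 (Finset.mem_sigma.mp hx).2, x.2⟩)
    (fun x hx => ⟨x.1.addCorner x.2 (Finset.mem_sigma.mp hx).2, x.2⟩) ?_ ?_ ?_ ?_
  · rintro ⟨T, c⟩ hx
    obtain ⟨h, hc⟩ := Finset.mem_sigma.mp hx
    exact Finset.mem_sigma.mpr ⟨mem_ofSize.mpr ((mem_ofSize (T := T)).mp h), mem_innerCorners_removeCorner hc⟩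
  · rintro ⟨T, c⟩ hx
    obtain ⟨h, hc⟩ := Finset.mem_sigma.mp hx
    exact Finset.mem_sigma.mpr ⟨mem_ofSize.mpr ((mem_ofSize (T := T)).mp h), mem_emptyCorners_addCorner hc⟩
  · rintro ⟨T, c⟩ hx
    exact Sigma.ext (addCorner_removeCorner (Finset.mem_sigma.mp hx).2) HEq.rfl
  · rintro ⟨T, c⟩ hx
    exact Sigma.ext (removeCorner_addCorner (Finset.mem_sigma.mp hx).2) HEq.rfl

/-- On average a tree-like tableau of a given size has one occupied corner. -/
theorem sum_oc_eq_card (n : ℕ) : ∑ T ∈ ofSize n, T.oc = (ofSize n).card := by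
  have h1 : ∑ T ∈ ofSize n, (T.oc + T.emptyCorners.card) =
      ∑ T ∈ ofSize n, (T.innerCorners.card + 1) :=
    Finset.sum_congr rfl fun T _ => by
      rw [oc_add_card_emptyCorners, card_innerCorners_add_one]
  rw [Finset.sum_add_distrib, Finset.sum_add_distrib, sum_card_emptyCorners, Finset.sum_const,
    smul_eq_mul, mul_one] at h1
  omega

/-! ### Deleting and inserting columns -/

/-- The occupied corners with a point to their left in their row. -/
def rightCorners (T : TreeLikeTableau) : Finset (ℕ × ℕ) :=
  T.corners ∩ T.rightPoints

theorem mem_rightCorners {T : TreeLikeTableau} {i j : ℕ} :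
    (i, j) ∈ T.rightCorners ↔ ((i, j) ∈ T.shape ∧ (i + 1, j) ∉ T.shape ∧ (i, j + 1) ∉ T.shape) ∧
      (i, j) ∈ T.points ∧ ∃ j' < j, (i, j') ∈ T.points := by
  rw [rightCorners, Finset.mem_inter, mem_corners, mem_rightPoints]

/-- The increasing map `ℕ → ℕ` whose range misses exactly `j`. -/
def skip (j b : ℕ) : ℕ := if b < j then b else b + 1

theorem skip_injective (j : ℕ) : Function.Injective (skip j) := by
  intro a b h
  unfold skip at h
  split_ifs at h <;> omega

theorem skip_mono (j : ℕ) : Monotone (skip j) := by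
  intro a b h
  unfold skip
  split_ifs <;> omega

theorem skip_lt_skip {j a b : ℕ} : skip j a < skip j b ↔ a < b := by
  unfold skip
  split_ifs <;> omega

theorem skip_ne (j b : ℕ) : skip j b ≠ j := by
  unfold skip
  split_ifs <;> omega

theorem exists_skip {j b : ℕ} (h : b ≠ j) : ∃ a, skip j a = b := by
  rcases lt_or_gt_of_ne h with h | h
  · exact ⟨b, if_pos h⟩
  · exact ⟨b - 1, by unfold skip; split_ifs <;> omega⟩

/-- The map of cells that makes room for a new column with index `j`. -/
def skipColumn (j : ℕ) : ℕ × ℕ ↪ ℕ × ℕ :=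
  (Function.Embedding.refl ℕ).prodMap ⟨skip j, skip_injective j⟩

@[simp]
theorem skipColumn_apply (j a b : ℕ) : skipColumn j (a, b) = (a, skip j b) := rfl

/-! ### Deleting the column of an occupied corner -/

section removeColumn

variable {T : TreeLikeTableau} {c : ℕ × ℕ}

theorem fst_le_of_mem_column (h : c ∈ T.rightCorners) {a : ℕ} (ha : (a, c.2) ∈ T.shape) :
    a ≤ c.1 := by
  by_contra hlt
  exact (mem_rightCorners.mp h).1.2.1 (T.shape.up_left_mem (by omega) le_rfl ha)

theorem snd_le_of_mem_row (h : c ∈ T.rightCorners) {b : ℕ} (hb : (c.1, b) ∈ T.shape) :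
    b ≤ c.2 := by
  by_contra hlt
  exact (mem_rightCorners.mp h).1.2.2 (T.shape.up_left_mem le_rfl (by omega) hb)

/-- The corner ends its column, and a point above it would conflict with the one to its left. Hence
deleting the column loses only this point. -/
theorem eq_fst_of_mem_column (h : c ∈ T.rightCorners) {a : ℕ} (ha : (a, c.2) ∈ T.points) :
    a = c.1 := by
  obtain ⟨hc, j', hj, hj'⟩ := (mem_rightCorners.mp h).2
  rcases lt_or_eq_of_le (fst_le_of_mem_column h (mem_shape_of_mem_points ha)) with hlt | rfl
  · exact (T.not_above_and_left hc hlt ha hj hj').elim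
  · rfl

theorem mem_preimage_skipColumn {s : Finset (ℕ × ℕ)} {a b j : ℕ} :
    (a, b) ∈ s.preimage (skipColumn j) (skipColumn j).injective.injOn ↔ (a, skip j b) ∈ s := by
  simp

/-- Delete the column of an occupied corner that has a point to its left. -/
noncomputable def removeColumn (T : TreeLikeTableau) (c : ℕ × ℕ) (h : c ∈ T.rightCorners) :
    TreeLikeTableau where
  shape :=
    { cells := T.shape.cells.preimage (skipColumn c.2) (skipColumn c.2).injective.injOn
      isLowerSet := by
        rintro ⟨a, b⟩ ⟨a', b'⟩ ⟨ha, hb⟩ hab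
        rw [Finset.mem_coe, mem_preimage_skipColumn, YoungDiagram.mem_cells] at hab ⊢
        exact T.shape.up_left_mem ha (skip_mono _ hb) hab }
  points := T.points.preimage (skipColumn c.2) (skipColumn c.2).injective.injOn
  points_subset := by
    rintro ⟨a, b⟩ hab
    rw [mem_preimage_skipColumn] at hab ⊢
    exact T.points_subset hab
  root_mem := by
    obtain ⟨-, j', hj, -⟩ := (mem_rightCorners.mp h).2
    rw [mem_preimage_skipColumn, skip, if_pos (by omega)]
    exact T.root_mem
  parent a b hab h0 := by
    simp only [mem_preimage_skipColumn] at hab ⊢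
    have h0' : (a, skip c.2 b) ≠ (0, 0) := by
      rintro e
      simp only [skip, Prod.mk.injEq] at e h0
      split_ifs at e <;> simp_all
    convert T.parent a _ hab h0' using 1
    refine ⟨fun ⟨k, hk, hk'⟩ => ⟨_, skip_lt_skip.mpr hk, hk'⟩, ?_⟩
    rintro ⟨k, hk, hk'⟩
    -- A left neighbour in the deleted column would be the corner itself, which has no cell to its
    -- right.
    have hne : k ≠ c.2 := by
      rintro rfl
      obtain rfl := eq_fst_of_mem_column h hk'
      exact hk.not_ge (snd_le_of_mem_row h (mem_shape_of_mem_points hab))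
    obtain ⟨k, rfl⟩ := exists_skip hne
    exact ⟨k, skip_lt_skip.mp hk, hk'⟩
  row_nonempty a b hab := by
    obtain ⟨k, hk⟩ := T.row_nonempty a _ (mem_preimage_skipColumn.mp hab)
    obtain ⟨l, hl⟩ : ∃ l, (a, skip c.2 l) ∈ T.points := by
      -- If the row's point is the deleted corner, the point to its left survives.
      by_cases hne : k = c.2
      · subst hne
        obtain rfl := eq_fst_of_mem_column h hk
        obtain ⟨-, j', hj, hj'⟩ := (mem_rightCorners.mp h).2
        obtain ⟨l, rfl⟩ := exists_skip hj.ne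
        exact ⟨l, hj'⟩
      · obtain ⟨l, rfl⟩ := exists_skip hne
        exact ⟨l, hk⟩
    exact ⟨l, mem_preimage_skipColumn.mpr hl⟩
  col_nonempty a b hab := by
    obtain ⟨k, hk⟩ := T.col_nonempty a _ (mem_preimage_skipColumn.mp hab)
    exact ⟨k, mem_preimage_skipColumn.mpr hk⟩

theorem mem_removeColumn_shape {h : c ∈ T.rightCorners} {a b : ℕ} :
    (a, b) ∈ (T.removeColumn c h).shape ↔ (a, skip c.2 b) ∈ T.shape :=
  mem_preimage_skipColumn

theorem mem_removeColumn_points {h : c ∈ T.rightCorners} {a b : ℕ} :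
    (a, b) ∈ (T.removeColumn c h).points ↔ (a, skip c.2 b) ∈ T.points :=
  mem_preimage_skipColumn

/-- The position of the deleted column can be read off from the row alone, so marking a row suffices
to undo the deletion. -/
theorem rowLen_removeColumn (h : c ∈ T.rightCorners) :
    (T.removeColumn c h).shape.rowLen c.1 = c.2 := by
  have key (b : ℕ) : b < (T.removeColumn c h).shape.rowLen c.1 ↔ b < c.2 := by
    rw [← YoungDiagram.mem_iff_lt_rowLen, mem_removeColumn_shape]
    constructor
    · intro hb
      have h1 := snd_le_of_mem_row h hb
      have h2 := skip_ne c.2 b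
      unfold skip at h1 h2
      split_ifs at h1 h2 <;> omega
    · intro hb
      rw [skip, if_pos hb]
      exact T.shape.up_left_mem le_rfl hb.le (mem_rightCorners.mp h).1.1
  exact eq_of_forall_lt_iff key

end removeColumn

/-! ### Inserting a column at the end of a row -/

section insertColumn

variable {T : TreeLikeTableau} {i : ℕ}

/-- The cells of `s` moved to make room for a column with index `j`, with `t` in this column. -/
def insertCells (s : Finset (ℕ × ℕ)) (j : ℕ) (t : Finset ℕ) : Finset (ℕ × ℕ) :=
  s.map (skipColumn j) ∪ t.map (Function.Embedding.sectL ℕ j)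

theorem mem_insertCells_skip {s : Finset (ℕ × ℕ)} {j : ℕ} {t : Finset ℕ} {a b : ℕ} :
    (a, skip j b) ∈ insertCells s j t ↔ (a, b) ∈ s := by
  have := skip_ne j b
  simp [insertCells, (skip_injective j).eq_iff, this.symm]

theorem mem_insertCells_self {s : Finset (ℕ × ℕ)} {j : ℕ} {t : Finset ℕ} {a : ℕ} :
    (a, j) ∈ insertCells s j t ↔ a ∈ t := by
  simp [insertCells, skip_ne]

theorem card_insertCells (s : Finset (ℕ × ℕ)) (j : ℕ) (t : Finset ℕ) :
    (insertCells s j t).card = s.card + t.card := by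
  rw [insertCells, Finset.card_union_of_disjoint, Finset.card_map, Finset.card_map]
  rw [Finset.disjoint_left]
  rintro ⟨a, b⟩ h h'
  simp only [Finset.mem_map, skipColumn_apply, Prod.exists, Prod.mk.injEq,
    Function.Embedding.sectL_apply] at h h'
  obtain ⟨_, k, -, -, rfl⟩ := h
  obtain ⟨_, -, -, h⟩ := h'
  exact skip_ne _ _ h.symm

/-- Insert a column just right of the last cell of row `i`, ending in that row with a point. -/
def insertColumn (T : TreeLikeTableau) (i : ℕ) (h : i < T.shape.colLen 0) : TreeLikeTableau where
  shape :=
    { cells := insertCells T.shape.cells (T.shape.rowLen i) (Finset.range (i + 1))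
      isLowerSet := by
        rintro ⟨a, b⟩ ⟨a', b'⟩ ⟨ha, hb⟩ hab
        simp only [Finset.mem_coe] at ha hb hab ⊢
        by_cases hb1 : b = T.shape.rowLen i <;> by_cases hb2 : b' = T.shape.rowLen i
        · subst hb1 hb2
          rw [mem_insertCells_self, Finset.mem_range] at hab ⊢
          omega
        · subst hb1
          obtain ⟨b', rfl⟩ := exists_skip hb2
          rw [mem_insertCells_self, Finset.mem_range] at hab
          rw [mem_insertCells_skip, YoungDiagram.mem_cells]
          have : b' < T.shape.rowLen i := by
            unfold skip at hb
            split_ifs at hb <;> omega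
          exact T.shape.up_left_mem (by omega) le_rfl (YoungDiagram.mem_iff_lt_rowLen.mpr this)
        · subst hb2
          obtain ⟨b, rfl⟩ := exists_skip hb1
          rw [mem_insertCells_skip, YoungDiagram.mem_cells] at hab
          rw [mem_insertCells_self, Finset.mem_range]
          -- Old cells right of the new column have index at least `rowLen i`, so they lie above row
          -- `i`, where the new column has cells.
          have hle : T.shape.rowLen i ≤ b := by
            unfold skip at hb
            split_ifs at hb <;> omega
          by_contra hlt
          have := YoungDiagram.mem_iff_lt_rowLen.mp
            (T.shape.up_left_mem (show i ≤ a by omega) hle hab)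
          omega
        · obtain ⟨b, rfl⟩ := exists_skip hb1
          obtain ⟨b', rfl⟩ := exists_skip hb2
          rw [mem_insertCells_skip, YoungDiagram.mem_cells] at hab ⊢
          have : b' ≤ b := by
            by_contra hlt
            exact hb.not_gt (skip_lt_skip.mpr (by omega))
          exact T.shape.up_left_mem ha this hab }
  points := insertCells T.points (T.shape.rowLen i) {i}
  points_subset := by
    rintro ⟨a, b⟩ hab
    by_cases hb : b = T.shape.rowLen i
    · subst hb
      rw [mem_insertCells_self] at hab ⊢
      simp_all
    · obtain ⟨b, rfl⟩ := exists_skip hb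
      rw [mem_insertCells_skip] at hab ⊢
      exact T.points_subset hab
  root_mem := by
    have hpos := YoungDiagram.mem_iff_lt_rowLen.mp (YoungDiagram.mem_iff_lt_colLen.mpr h)
    have h0 : skip (T.shape.rowLen i) 0 = 0 := if_pos hpos
    have := T.root_mem
    rwa [← mem_insertCells_skip (j := T.shape.rowLen i) (t := {i}), h0] at this
  parent a b hab h0 := by
    by_cases hb : b = T.shape.rowLen i
    · subst hb
      simp only [mem_insertCells_self, Finset.mem_singleton] at hab ⊢
      subst hab
      -- The new point is alone in its column, and row `i` already had a point, necessarily to its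
      -- left.
      refine .inr ⟨?_, by simp⟩
      obtain ⟨k, hk⟩ := T.row_nonempty _ _ (YoungDiagram.mem_iff_lt_colLen.mpr h)
      have hlt := YoungDiagram.mem_iff_lt_rowLen.mp (mem_shape_of_mem_points hk)
      have hs : skip (T.shape.rowLen a) k = k := if_pos hlt
      refine ⟨skip (T.shape.rowLen a) k, by omega, mem_insertCells_skip.mpr hk⟩
    · obtain ⟨b, rfl⟩ := exists_skip hb
      simp only [mem_insertCells_skip] at hab ⊢
      have h0' : (a, b) ≠ (0, 0) := by
        rintro ⟨⟩
        have hpos := YoungDiagram.mem_iff_lt_rowLen.mp (YoungDiagram.mem_iff_lt_colLen.mpr h)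
        exact h0 (by simp [skip, hpos])
      convert T.parent a b hab h0' using 1
      refine ⟨?_, fun ⟨k, hk, hk'⟩ =>
        ⟨_, skip_lt_skip.mpr hk, mem_insertCells_skip.mpr hk'⟩⟩
      rintro ⟨k, hk, hk'⟩
      -- The new point is never to the left of an old one: it lies beyond every old cell of row `i`.
      have hne : k ≠ T.shape.rowLen i := by
        rintro rfl
        obtain rfl := Finset.mem_singleton.mp (mem_insertCells_self.mp hk')
        have := YoungDiagram.mem_iff_lt_rowLen.mp (mem_shape_of_mem_points hab)
        unfold skip at hk
        rw [if_pos this] at hk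
        omega
      obtain ⟨k, rfl⟩ := exists_skip hne
      exact ⟨k, skip_lt_skip.mp hk, mem_insertCells_skip.mp hk'⟩
  row_nonempty a b hab := by
    obtain ⟨k, hk⟩ : ∃ k, (a, k) ∈ T.points := by
      replace hab := (YoungDiagram.mem_cells _).mpr hab
      by_cases hb : b = T.shape.rowLen i
      · subst hb
        have := Finset.mem_range.mp (mem_insertCells_self.mp hab)
        exact T.row_nonempty a 0 (YoungDiagram.mem_iff_lt_colLen.mpr (by omega))
      · obtain ⟨b, rfl⟩ := exists_skip hb
        exact T.row_nonempty _ _ ((YoungDiagram.mem_cells _).mp (mem_insertCells_skip.mp hab))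
    exact ⟨_, mem_insertCells_skip.mpr hk⟩
  col_nonempty a b hab := by
    replace hab := (YoungDiagram.mem_cells _).mpr hab
    by_cases hb : b = T.shape.rowLen i
    · subst hb
      exact ⟨i, mem_insertCells_self.mpr (Finset.mem_singleton_self i)⟩
    · obtain ⟨b, rfl⟩ := exists_skip hb
      obtain ⟨k, hk⟩ :=
        T.col_nonempty _ _ ((YoungDiagram.mem_cells _).mp (mem_insertCells_skip.mp hab))
      exact ⟨k, mem_insertCells_skip.mpr hk⟩

theorem mem_insertColumn_shape_skip {h : i < T.shape.colLen 0} {a b : ℕ} :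
    (a, skip (T.shape.rowLen i) b) ∈ (T.insertColumn i h).shape ↔ (a, b) ∈ T.shape :=
  mem_insertCells_skip

theorem mem_insertColumn_shape_self {h : i < T.shape.colLen 0} {a : ℕ} :
    (a, T.shape.rowLen i) ∈ (T.insertColumn i h).shape ↔ a ≤ i :=
  mem_insertCells_self.trans Finset.mem_range_succ_iff

theorem mem_insertColumn_points_skip {h : i < T.shape.colLen 0} {a b : ℕ} :
    (a, skip (T.shape.rowLen i) b) ∈ (T.insertColumn i h).points ↔ (a, b) ∈ T.points :=
  mem_insertCells_skip

theorem mem_insertColumn_points_self {h : i < T.shape.colLen 0} {a : ℕ} :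
    (a, T.shape.rowLen i) ∈ (T.insertColumn i h).points ↔ a = i :=
  mem_insertCells_self.trans Finset.mem_singleton

theorem size_insertColumn (h : i < T.shape.colLen 0) :
    (T.insertColumn i h).size = T.size + 1 :=
  card_insertCells _ _ _

theorem mem_rightCorners_insertColumn (h : i < T.shape.colLen 0) :
    (i, T.shape.rowLen i) ∈ (T.insertColumn i h).rightCorners := by
  rw [mem_rightCorners, mem_insertColumn_shape_self, mem_insertColumn_shape_self,
    mem_insertColumn_points_self]
  refine ⟨⟨le_rfl, by omega, ?_⟩, rfl, ?_⟩
  · have hs : skip (T.shape.rowLen i) (T.shape.rowLen i) = T.shape.rowLen i + 1 :=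
      if_neg (lt_irrefl _)
    rw [← hs, mem_insertColumn_shape_skip, YoungDiagram.mem_iff_lt_rowLen]
    exact lt_irrefl _
  · obtain ⟨k, hk⟩ := T.row_nonempty _ _ (YoungDiagram.mem_iff_lt_colLen.mpr h)
    have hlt := YoungDiagram.mem_iff_lt_rowLen.mp (mem_shape_of_mem_points hk)
    have hs : skip (T.shape.rowLen i) k = k := if_pos hlt
    exact ⟨skip (T.shape.rowLen i) k, by omega, mem_insertColumn_points_skip.mpr hk⟩

theorem removeColumn_insertColumn (h : i < T.shape.colLen 0) :
    (T.insertColumn i h).removeColumn _ (mem_rightCorners_insertColumn h) = T := by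
  apply TreeLikeTableau.ext
  · ext ⟨a, b⟩
    rw [YoungDiagram.mem_cells, YoungDiagram.mem_cells, mem_removeColumn_shape,
      mem_insertColumn_shape_skip]
  · ext ⟨a, b⟩
    rw [mem_removeColumn_points, mem_insertColumn_points_skip]

theorem fst_lt_colLen_removeColumn {c : ℕ × ℕ} (h : c ∈ T.rightCorners) :
    c.1 < (T.removeColumn c h).shape.colLen 0 := by
  obtain ⟨-, j', hj, hj'⟩ := (mem_rightCorners.mp h).2
  rw [← YoungDiagram.mem_iff_lt_colLen, mem_removeColumn_shape, skip, if_pos (by omega)]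
  exact T.shape.up_left_mem le_rfl (Nat.zero_le _) (mem_shape_of_mem_points hj')

theorem insertColumn_removeColumn {c : ℕ × ℕ} (h : c ∈ T.rightCorners) :
    (T.removeColumn c h).insertColumn c.1 (fst_lt_colLen_removeColumn h) = T := by
  have hr := rowLen_removeColumn h
  apply TreeLikeTableau.ext
  · ext ⟨a, b⟩
    rw [YoungDiagram.mem_cells, YoungDiagram.mem_cells]
    by_cases hb : b = c.2
    · rw [hb]
      conv_lhs => rw [← hr]
      rw [mem_insertColumn_shape_self]
      exact ⟨fun ha => T.shape.up_left_mem ha le_rfl (mem_rightCorners.mp h).1.1,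
        fst_le_of_mem_column h⟩
    · obtain ⟨b, rfl⟩ := exists_skip hb
      conv_lhs => rw [← hr]
      rw [mem_insertColumn_shape_skip, mem_removeColumn_shape]
  · ext ⟨a, b⟩
    by_cases hb : b = c.2
    · rw [hb]
      conv_lhs => rw [← hr]
      rw [mem_insertColumn_points_self]
      refine ⟨?_, eq_fst_of_mem_column h⟩
      rintro rfl
      exact (mem_rightCorners.mp h).2.1
    · obtain ⟨b, rfl⟩ := exists_skip hb
      conv_lhs => rw [← hr]
      rw [mem_insertColumn_points_skip, mem_removeColumn_points]

theorem size_removeColumn_add_one {c : ℕ × ℕ} (h : c ∈ T.rightCorners) :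
    (T.removeColumn c h).size + 1 = T.size := by
  rw [← size_insertColumn (fst_lt_colLen_removeColumn h), insertColumn_removeColumn]

end insertColumn

/-- Deletion and insertion of columns are inverse bijections between tableaux with a marked corner
of this kind and smaller tableaux with a marked row. -/
theorem sum_card_rightCorners (n : ℕ) :
    ∑ T ∈ ofSize (n + 1), T.rightCorners.card = ∑ T ∈ ofSize n, T.shape.colLen 0 := by
  trans ∑ T ∈ ofSize n, (Finset.range (T.shape.colLen 0)).card
  swap
  · simp only [Finset.card_range]
  rw [← Finset.card_sigma, ← Finset.card_sigma]
  refine Finset.card_bij'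
    (fun x hx => ⟨x.1.removeColumn x.2 (Finset.mem_sigma.mp hx).2, x.2.1⟩)
    (fun x hx => ⟨x.1.insertColumn x.2 (Finset.mem_range.mp (Finset.mem_sigma.mp hx).2),
      (x.2, x.1.shape.rowLen x.2)⟩) ?_ ?_ ?_ ?_
  · rintro ⟨T, c⟩ hx
    obtain ⟨h, hc⟩ := Finset.mem_sigma.mp hx
    refine Finset.mem_sigma.mpr
      ⟨mem_ofSize.mpr ?_, Finset.mem_range.mpr (fst_lt_colLen_removeColumn hc)⟩
    have h1 := size_removeColumn_add_one hc
    have h2 := mem_ofSize.mp h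
    simp only at h1 h2 ⊢
    omega
  · rintro ⟨T, i⟩ hx
    obtain ⟨h, hc⟩ := Finset.mem_sigma.mp hx
    refine Finset.mem_sigma.mpr ⟨mem_ofSize.mpr ?_, mem_rightCorners_insertColumn (Finset.mem_range.mp hc)⟩
    rw [size_insertColumn, (mem_ofSize (T := T)).mp h]
  · rintro ⟨T, c⟩ hx
    obtain ⟨h, hc⟩ := Finset.mem_sigma.mp hx
    refine Sigma.ext (insertColumn_removeColumn hc) (heq_of_eq ?_)
    exact Prod.ext rfl (rowLen_removeColumn hc)
  · rintro ⟨T, c⟩ hx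
    exact Sigma.ext (removeColumn_insertColumn (Finset.mem_range.mp (Finset.mem_sigma.mp hx).2)) HEq.rfl

/-! ### Counting -/

theorem rightCorners_transpose (T : TreeLikeTableau) :
    T.transpose.rightCorners =
      (T.corners ∩ T.belowPoints).map (Equiv.prodComm ℕ ℕ).toEmbedding := by
  ext ⟨i, j⟩
  simp [mem_rightCorners, mem_corners, mem_belowPoints, and_comm]

/-- The root has a point neither above nor to its left, so it must be excluded before the occupied
corners are split into two kinds. In size `1` it is an occupied corner. -/
theorem root_notMem_corners {T : TreeLikeTableau} (h : 2 ≤ T.size) : (0, 0) ∉ T.corners := by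
  intro h0
  obtain ⟨-, h1, h2⟩ := mem_corners.mp h0
  obtain ⟨⟨i, j⟩, hc, hne⟩ := Finset.exists_mem_ne h (0, 0)
  replace hc := mem_shape_of_mem_points hc
  obtain _ | i := i
  · obtain _ | j := j
    · exact hne rfl
    · exact h2 (T.shape.up_left_mem le_rfl (by omega) hc)
  · exact h1 (T.shape.up_left_mem (by omega) (Nat.zero_le _) hc)

theorem oc_eq_add {T : TreeLikeTableau} (h : 2 ≤ T.size) :
    T.oc = T.transpose.rightCorners.card + T.rightCorners.card := by
  rw [rightCorners_transpose, Finset.card_map, rightCorners, ← Finset.card_union_of_disjoint,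
    ← Finset.inter_union_distrib_left, belowPoints_union_rightPoints, Finset.inter_erase,
    Finset.erase_eq_of_notMem fun h0 => root_notMem_corners h (Finset.mem_inter.mp h0).1,
    oc, occupiedCorners, Finset.filter_mem_eq_inter]
  exact T.disjoint_belowPoints_rightPoints.mono Finset.inter_subset_right Finset.inter_subset_right

theorem sum_oc_succ {n : ℕ} (hn : 1 ≤ n) :
    ∑ T ∈ ofSize (n + 1), T.oc = (n + 1) * (ofSize n).card := by
  calc ∑ T ∈ ofSize (n + 1), T.oc
      = ∑ T ∈ ofSize (n + 1), (T.transpose.rightCorners.card + T.rightCorners.card) :=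
        Finset.sum_congr rfl fun T hT => oc_eq_add (by rw [mem_ofSize.mp hT]; omega)
    _ = ∑ T ∈ ofSize n, (T.shape.colLen 0 + T.transpose.shape.colLen 0) := by
        rw [Finset.sum_add_distrib, Finset.sum_add_distrib,
          sum_ofSize_transpose (n + 1) fun T => T.rightCorners.card,
          sum_ofSize_transpose n fun T => T.shape.colLen 0, sum_card_rightCorners]
    _ = ∑ T ∈ ofSize n, (n + 1) := Finset.sum_congr rfl fun T hT => by
        rw [← mem_ofSize.mp hT, ← colLen_add_rowLen]
        exact congrArg _ (T.shape.colLen_transpose 0)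
    _ = (n + 1) * (ofSize n).card := by
        rw [Finset.sum_const, smul_eq_mul, mul_comm]

/-- The tree-like tableau with a single cell. -/
def singleCell : TreeLikeTableau where
  shape :=
    { cells := {(0, 0)}
      isLowerSet := by
        intro a b hba ha
        simp only [Finset.coe_singleton, Set.mem_singleton_iff] at ha ⊢
        subst ha
        exact le_antisymm hba bot_le }
  points := {(0, 0)}
  points_subset := subset_rfl
  root_mem := Finset.mem_singleton_self _
  parent _ _ h h0 := (h0 (Finset.mem_singleton.mp h)).elim
  row_nonempty _ j h := ⟨j, h⟩
  col_nonempty i _ h := ⟨i, h⟩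

theorem ofSize_one : ofSize 1 = {singleCell} := by
  ext T
  rw [mem_ofSize, Finset.mem_singleton]
  constructor
  · intro h
    have hs : T.shape.cells = {(0, 0)} := by
      refine Finset.Subset.antisymm ?_ (Finset.singleton_subset_iff.mpr T.root_mem_shape)
      -- A tableau of size `1` fits in a `1 × 1` box.
      have := T.shape_subset
      rwa [h] at this
    refine TreeLikeTableau.ext (YoungDiagram.ext hs) ?_
    exact Finset.Subset.antisymm (T.points_subset.trans hs.subset)
      (Finset.singleton_subset_iff.mpr T.root_mem)
  · rintro rfl
    rfl

theorem card_ofSize {n : ℕ} (hn : 1 ≤ n) : (ofSize n).card = n.factorial := by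
  induction n, hn using Nat.le_induction with
  | base => rw [ofSize_one, Finset.card_singleton, Nat.factorial_one]
  | succ n hn ih => rw [← sum_oc_eq_card, sum_oc_succ hn, ih, Nat.factorial_succ]

end TreeLikeTableau

theorem theorem1 (n : ℕ) (hn : 1 ≤ n) :
    ∑ T ∈ TreeLikeTableau.ofSize n, T.oc = n.factorial ∧
      ((∑ T ∈ TreeLikeTableau.ofSize n, T.oc : ℕ) : ℚ) / ((TreeLikeTableau.ofSize n).card : ℚ) = 1 := by
  rw [TreeLikeTableau.sum_oc_eq_card, TreeLikeTableau.card_ofSize hn]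
  exact ⟨rfl, div_self (Nat.cast_ne_zero.mpr n.factorial_ne_zero)⟩
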